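/- Let $R$ be a left noetherian ring and $S$ a right noetherian ring. Let $\mathfrak D^b(R\text{-mod})$ (resp. $\mathfrak D^b(\text{mod-}S)$) denote the full subcategory of the derived category of left $R$-modules (resp. right $S$-modules) of complexes with bounded cohomology all of whose cohomology modules are finitely generated. For a complex $C^\bullet$ of $(R,S)$-bimodules (with bimodule differentials) and a complex $M^\bullet$ of left $R$-modules with bounded above cohomology, $\mathbf R\mathrm{Hom}_R(M^\bullet,C^\bullet)$ is the complex of right $S$-modules $\mathrm{Hom}_R(P^\bullet,C^\bullet)$, where $P^\bullet\to M^\bullet$ is a (bounded above) projective resolution; $\mathbf R\mathrm{Hom}_S(-,C^\bullet)$ is defined symmetrically. The complex $C^\bullet$ is called *semi-dualizing* if 1. $H^i(C^\bullet)\neq 0$ for only finitely many $i$; 2. the right homothety morphism $S\to\mathbf R\mathrm{Hom}_R(C^\bullet,C^\bullet)$ is an isomorphism in the derived category of right $S$-modules; 3. the left homothety morphism $R\to\mathbf R\mathrm{Hom}_S(C^\bullet,C^\bullet)$ is an isomorphism in the derived category of left $R$-modules. Let $\mathcal R_R(C^\bullet)$ be the full subcategory of those $M^\bullet\in\mathfrak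 D^b(R\text{-mod})$ for which $\mathbf R\mathrm{Hom}_R(M^\bullet,C^\bullet)\in\mathfrak D^b(\text{mod-}S)$ and the natural morphism $M^\bullet\to\mathbf R\mathrm{Hom}_S(\mathbf R\mathrm{Hom}_R(M^\bullet,C^\bullet),C^\bullet)$ is an isomorphism, and let $\mathcal R_S(C^\bullet)\subseteq\mathfrak D^b(\text{mod-}S)$ be defined symmetrically. **Theorem.** Let $C^\bullet$ be a semi-dualizing complex of $(R,S)$-bimodules. Then $\mathbf R\mathrm{Hom}_R(-,C^\bullet)$ sends $\mathcal R_R(C^\bullet)$ into $\mathcal R_S(C^\bullet)$, $\mathbf R\mathrm{Hom}_S(-,C^\bullet)$ sends $\mathcal R_S(C^\bullet)$ into $\mathcal R_R(C^\bullet)$, and the resulting contravariant functors $$\mathcal R_R(C^\bullet)^{\mathrm{op}}\to\mathcal R_S(C^\bullet),\qquad \mathcal R_S(C^\bullet)^{\mathrm{op}}\to\mathcal R_R(C^\bullet)$$ are mutually quasi-inverse equivalences of categories (a duality), the natural morphisms $M^\bullet\to\mathbf R\mathrm{Hom}_S(\mathbf R\mathrm{Hom}_R(M^\bullet,C^\bullet),C^\bullet)$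 and $N^\bullet\to\mathbf R\mathrm{Hom}_R(\mathbf R\mathrm{Hom}_S(N^\bullet,C^\bullet),C^\bullet)$ being natural isomorphisms from the identity functors to the two compositions. -/

import Mathlib

open CategoryTheory CochainComplex.HomComplex

universe w w' u v

/-! ### Bounded above projective resolutions -/

section Resolutions

variable {V : Type u} [Category.{v} V] [Abelian V]

lemma quasiIso_of_quasiIso_op {K L : CochainComplex V ℤ} (f : K ⟶ L)
    (h : QuasiIso ((CochainComplex.opEquivalence V).functor.map f.op)) : QuasiIso f := by
  rw [quasiIso_iff]
  intro n
  obtain ⟨m, rfl⟩ : ∃ m, n = -m := ⟨-n, by simp⟩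
  rw [quasiIsoAt_iff' f (- (m + 1)) (-m) (- (m - 1)) (by simp; lia) (by simp; lia)]
  have h' := (quasiIso_iff _).1 h m
  rw [quasiIsoAt_iff' _ (m - 1) m (m + 1) (by simp) (by simp)] at h'
  rw [← ShortComplex.quasiIso_opMap_iff]
  exact h'

lemma exists_projective_quasiIso [EnoughProjectives V] (K : CochainComplex V ℤ) (n : ℤ)
    [K.IsStrictlyLE n] :
    ∃ (P : CochainComplex V ℤ) (f : P ⟶ K), QuasiIso f ∧ (∀ i, Projective (P.X i)) ∧
      P.IsStrictlyLE n := by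
  let e := CochainComplex.opEquivalence V
  have : (e.functor.obj (.op K)).IsStrictlyGE (-n) := by
    rw [CochainComplex.isStrictlyGE_iff]
    intro i hi
    exact (K.isZero_of_isStrictlyLE n (-i) (by lia)).op
  obtain ⟨L, i, hi, hL, hn⟩ :=
    CochainComplex.Plus.modelCategoryQuillen.exists_quasiIso_injective (e.functor.obj (.op K)) (-n)
  refine ⟨(e.inverse.obj L).unop, (e.unitIso.hom.app (.op K) ≫ e.inverse.map i).unop, ?_, ?_, ?_⟩
  · apply quasiIso_of_quasiIso_op
    have : e.functor.map (e.unitIso.hom.app (.op K) ≫ e.inverse.map i) =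
        i ≫ e.counitIso.inv.app L := by
      rw [← cancel_mono (e.counitIso.hom.app L)]
      simp
    change QuasiIso (e.functor.map (e.unitIso.hom.app (.op K) ≫ e.inverse.map i))
    rw [this]
    infer_instance
  · intro j
    exact inferInstanceAs (Projective (L.X (-j)).unop)
  · rw [CochainComplex.isStrictlyLE_iff]
    intro j hj
    exact (L.isZero_of_isStrictlyGE (-n) (-j) (by lia)).unop

variable [HasDerivedCategory.{w} V]

lemma exists_projective_iso [EnoughProjectives V]
    (K : DerivedCategory V) (hK : DerivedCategory.TStructure.t.minus K) :
    ∃ (P : CochainComplex V ℤ), (∀ i, Projective (P.X i)) ∧ (∃ n, P.IsStrictlyLE n) ∧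
      Nonempty (DerivedCategory.Qh.obj ((HomotopyCategory.quotient V _).obj P) ≅ K) := by
  obtain ⟨n, hn⟩ := hK
  obtain ⟨L, hL, ⟨e⟩⟩ := K.exists_iso_Q_obj_of_isLE n
  obtain ⟨P, f, hf, hP, hn⟩ := exists_projective_quasiIso L n
  exact ⟨P, hP, ⟨n, hn⟩, ⟨(DerivedCategory.quotientCompQhIso V).app P ≪≫
    asIso (DerivedCategory.Q.map f) ≪≫ e.symm⟩⟩

/-- A morphism in the derived category from a K-projective complex lifts (uniquely) to a
morphism in the homotopy category. -/
noncomputable def liftOfKProjective (P : CochainComplex V ℤ) [P.IsKProjective]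
    (L : HomotopyCategory V (.up ℤ))
    (f : DerivedCategory.Qh.obj ((HomotopyCategory.quotient V _).obj P) ⟶
      DerivedCategory.Qh.obj L) :
    (HomotopyCategory.quotient V _).obj P ⟶ L :=
  ((CochainComplex.IsKProjective.Qh_map_bijective P L).surjective f).choose

@[simp]
lemma map_liftOfKProjective (P : CochainComplex V ℤ) [P.IsKProjective]
    (L : HomotopyCategory V (.up ℤ))
    (f : DerivedCategory.Qh.obj ((HomotopyCategory.quotient V _).obj P) ⟶
      DerivedCategory.Qh.obj L) :
    DerivedCategory.Qh.map (liftOfKProjective P L f) = f :=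
  ((CochainComplex.IsKProjective.Qh_map_bijective P L).surjective f).choose_spec

variable [EnoughProjectives V]

namespace DerivedCategory.Minus

/-- A chosen projective resolution of `M`: a bounded above complex of projective objects. -/
noncomputable def res (M : Minus V) : CochainComplex V ℤ :=
  (exists_projective_iso M.obj M.property).choose

lemma projective_res (M : Minus V) (i : ℤ) : Projective (M.res.X i) :=
  (exists_projective_iso M.obj M.property).choose_spec.1 i

lemma isStrictlyLE_res (M : Minus V) : ∃ n, M.res.IsStrictlyLE n :=
  (exists_projective_iso M.obj M.property).choose_spec.2.1

instance (M : Minus V) : M.res.IsKProjective := by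
  obtain ⟨n, hn⟩ := M.isStrictlyLE_res
  have := M.projective_res
  exact CochainComplex.isKProjective_of_projective M.res n

/-- The identification of the chosen resolution of `M` with `M` in the derived category. -/
noncomputable def resIso (M : Minus V) :
    Qh.obj ((HomotopyCategory.quotient V _).obj M.res) ≅ M.obj :=
  (exists_projective_iso M.obj M.property).choose_spec.2.2.some

variable (V) in
/-- Projective resolutions, as a functor from the bounded above derived category to the homotopy
category. -/
noncomputable def resFunctor : Minus V ⥤ HomotopyCategory V (.up ℤ) where
  obj M := (HomotopyCategory.quotient V _).obj M.res
  map {M N} f := liftOfKProjective M.res _ (M.resIso.hom ≫ f.hom ≫ N.resIso.inv)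
  map_id M := (CochainComplex.IsKProjective.Qh_map_bijective _ _).injective (by simp)
  map_comp f g := (CochainComplex.IsKProjective.Qh_map_bijective _ _).injective (by simp)

end DerivedCategory.Minus

end Resolutions

/-! ### Complexes of bimodules -/

/-- A cochain complex of bimodules over `A` and `B` and bimodule homomorphisms: each term carries
two commuting left module structures, over `A` and over `B`. As right `S`-modules are left modules
over `Sᵐᵒᵖ`, a complex of `(R, S)`-bimodules is a `BimoduleComplex R Sᵐᵒᵖ`. -/
structure BimoduleComplex (A B : Type u) [Ring A] [Ring B] where
  /-- the terms -/
  X : ℤ → Type u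
  [addCommGroup : ∀ n, AddCommGroup (X n)]
  [module₁ : ∀ n, Module A (X n)]
  [module₂ : ∀ n, Module B (X n)]
  [smulComm : ∀ n, SMulCommClass A B (X n)]
  /-- the differentials (zero unless `i + 1 = j`) -/
  d : ∀ i j, X i →+ X j
  d_smul₁ : ∀ i j (a : A) (x : X i), d i j (a • x) = a • d i j x
  d_smul₂ : ∀ i j (b : B) (x : X i), d i j (b • x) = b • d i j x
  shape : ∀ i j, i + 1 ≠ j → d i j = 0
  d_comp_d : ∀ i j k (x : X i), d j k (d i j x) = 0

lemma negOnePow_smul_comm {D N : Type*} [Ring D] [AddCommGroup N] [Module D N] (n : ℤ) (r : D)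
    (x : N) : n.negOnePow • r • x = r • n.negOnePow • x := by
  rw [Units.smul_def, Units.smul_def, smul_comm]

lemma comp_homotopy_sign {V : Type*} [Category V] [Preadditive V] {K L N : CochainComplex V ℤ}
    (s : Cochain K L (-1)) {p : ℤ} (z : Cochain L N p) :
    (δ (-1) 0 s).comp z (zero_add p) =
      δ (p - 1) p (p.negOnePow • s.comp z (by omega)) +
        (p + 1).negOnePow • s.comp (δ p (p + 1) z) (by omega) := by
  rw [δ_units_smul, δ_comp s z (by omega : -1 + p = p - 1) 0 (p + 1) p (by omega)
    (by omega) rfl, Int.negOnePow_succ, smul_add, smul_smul, ← Int.negOnePow_add,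
    Int.negOnePow_even _ ⟨p, rfl⟩, one_smul, Units.neg_smul]
  abel

namespace BimoduleComplex

attribute [instance] addCommGroup module₁ module₂ smulComm

variable {A B : Type u} [Ring A] [Ring B]

/-- The same complex of bimodules, with the roles of the two rings exchanged. -/
def flip (C : BimoduleComplex A B) : BimoduleComplex B A where
  X := C.X
  module₁ := C.module₂
  module₂ := C.module₁
  smulComm _ := ⟨fun b a x => (smul_comm a b x).symm⟩
  d := C.d
  d_smul₁ := C.d_smul₂
  d_smul₂ := C.d_smul₁
  shape := C.shape
  d_comp_d := C.d_comp_d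

/-- The underlying complex of `A`-modules. -/
def toComplex (C : BimoduleComplex A B) : CochainComplex (ModuleCat.{u} A) ℤ where
  X n := ModuleCat.of A (C.X n)
  d i j := ModuleCat.ofHom { C.d i j with map_smul' := C.d_smul₁ i j }
  shape i j h := by
    ext x
    exact DFunLike.congr_fun (C.shape i j h) x
  d_comp_d' i j k _ _ := by
    ext x
    exact C.d_comp_d i j k x

/-- Multiplication by `b : B`, a chain map of complexes of `A`-modules. -/
def smulHom (C : BimoduleComplex A B) (b : B) : C.toComplex ⟶ C.toComplex where
  f n := ModuleCat.ofHom
    { toFun := fun x : C.X n => b • x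
      map_add' := smul_add b
      map_smul' := fun a x => (smul_comm a b x).symm }
  comm' i j _ := by
    ext x
    exact C.d_smul₂ i j b x

lemma smulHom_one (C : BimoduleComplex A B) : C.smulHom 1 = 𝟙 C.toComplex := by
  ext n x
  exact one_smul (M := B) (α := C.X n) x

lemma smulHom_mul (C : BimoduleComplex A B) (b b' : B) :
    C.smulHom (b * b') = C.smulHom b' ≫ C.smulHom b := by
  ext n x
  exact mul_smul (β := C.X n) b b' x

lemma smulHom_add (C : BimoduleComplex A B) (b b' : B) :
    C.smulHom (b + b') = C.smulHom b + C.smulHom b' := by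
  ext n x
  exact add_smul (M := C.X n) b b' x

lemma smulHom_zero (C : BimoduleComplex A B) : C.smulHom 0 = 0 := by
  ext n x
  exact zero_smul B (A := C.X n) x

/-- The term of degree `n` of `Hom_A(M, C)`, i.e. the product of all `Hom_A(M^p, C^q)` with
`p + n = q`. It is a `B`-module through the action of `B` on `C`. -/
def HomX (C : BimoduleComplex A B) (M : CochainComplex (ModuleCat.{u} A) ℤ) (n : ℤ) : Type u :=
  Cochain M C.toComplex n

namespace HomX
variable (C : BimoduleComplex A B) (M : CochainComplex (ModuleCat.{u} A) ℤ) (n : ℤ)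

instance : AddCommGroup (C.HomX M n) := inferInstanceAs (AddCommGroup (Cochain M C.toComplex n))

instance : Module B (C.HomX M n) where
  smul b z := Cochain.comp (n₁ := n) z (Cochain.ofHom (C.smulHom b)) (add_zero n)
  one_smul (z : Cochain M C.toComplex n) :=
    (congrArg (fun f => z.comp (Cochain.ofHom f) (add_zero n)) C.smulHom_one).trans
      (Cochain.comp_id z)
  mul_smul b b' (z : Cochain M C.toComplex n) := by
    refine (congrArg (fun f => z.comp (Cochain.ofHom f) (add_zero n)) (C.smulHom_mul b b')).trans ?_
    refine (congrArg (fun f => z.comp f (add_zero n)) (Cochain.ofHom_comp _ _)).trans ?_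
    exact (Cochain.comp_assoc_of_third_is_zero_cochain z _ _ (add_zero n)).symm
  smul_zero _ := Cochain.zero_comp _ _
  smul_add _ _ _ := Cochain.add_comp _ _ _ _
  add_smul b b' (z : Cochain M C.toComplex n) := by
    refine (congrArg (fun f => z.comp (Cochain.ofHom f) (add_zero n)) (C.smulHom_add b b')).trans ?_
    refine (congrArg (fun f => z.comp f (add_zero n)) (Cochain.ofHom_add _ _)).trans ?_
    exact Cochain.comp_add _ _ _ _
  zero_smul (z : Cochain M C.toComplex n) := by
    refine (congrArg (fun f => z.comp (Cochain.ofHom f) (add_zero n)) C.smulHom_zero).trans ?_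
    refine (congrArg (fun f => z.comp f (add_zero n)) (Cochain.ofHom_zero _ _)).trans ?_
    exact Cochain.comp_zero _ _

end HomX

lemma HomX.smul_eq (C : BimoduleComplex A B) (M : CochainComplex (ModuleCat.{u} A) ℤ) (n : ℤ)
    (b : B) (z : C.HomX M n) :
    b • z = Cochain.comp (n₁ := n) z (Cochain.ofHom (C.smulHom b)) (add_zero n) := rfl

/-- The complex `Hom_A(M, C)` of `B`-modules, with Mathlib's differential
`f ↦ d ∘ f - (-1) ^ n • f ∘ d` in degree `n`. -/
def hom (C : BimoduleComplex A B) (M : CochainComplex (ModuleCat.{u} A) ℤ) :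
    CochainComplex (ModuleCat.{u} B) ℤ where
  X n := ModuleCat.of B (C.HomX M n)
  d i j := ModuleCat.ofHom
    { toFun := fun z : Cochain M C.toComplex i => (δ i j z : Cochain M C.toComplex j)
      map_add' := fun z z' => δ_add (n := i) (m := j) z z'
      map_smul' := fun b z => δ_comp_ofHom z (C.smulHom b) j }
  shape i j h := by
    ext z
    exact δ_shape i j h z
  d_comp_d' i j k _ _ := by
    ext z
    exact δ_δ i j k z

/-- The chain map `Hom_A(M', C) ⟶ Hom_A(M, C)`, precomposition with `f : M ⟶ M'`. -/
def homMap (C : BimoduleComplex A B) {M M' : CochainComplex (ModuleCat.{u} A) ℤ} (f : M ⟶ M') :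
    C.hom M' ⟶ C.hom M where
  f n := ModuleCat.ofHom
    { toFun := fun z : Cochain M' C.toComplex n =>
        ((Cochain.ofHom f).comp z (zero_add n) : Cochain M C.toComplex n)
      map_add' := fun z z' => Cochain.comp_add _ _ _ _
      map_smul' := fun b z => (Cochain.comp_assoc_of_third_is_zero_cochain
          (Cochain.ofHom f) z (Cochain.ofHom (C.smulHom b)) (zero_add n)).symm }
  comm' i j _ := by
    ext z
    exact δ_ofHom_comp f (n := i) z j

/-- The contravariant functor `Hom_A(-, C)` on complexes. -/
def homFunctor (C : BimoduleComplex A B) :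
    CochainComplex (ModuleCat.{u} A) ℤ ⥤ (CochainComplex (ModuleCat.{u} B) ℤ)ᵒᵖ where
  obj M := Opposite.op (C.hom M)
  map f := (C.homMap f).op
  map_id M := by
    refine Quiver.Hom.unop_inj ?_
    ext n z
    exact Cochain.id_comp (n := n) z
  map_comp f g := by
    refine Quiver.Hom.unop_inj ?_
    ext n z
    refine (congrArg (fun t => Cochain.comp t (n₂ := n) z (zero_add n)) (Cochain.ofHom_comp f g)).trans ?_
    exact Cochain.comp_assoc_of_first_is_zero_cochain (Cochain.ofHom f)
      (n₃ := n) (Cochain.ofHom g) z (zero_add n)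

lemma homMap_homotopy (C : BimoduleComplex A B) {M M' : CochainComplex (ModuleCat.{u} A) ℤ}
    {f g : M ⟶ M'} (h : Homotopy f g) : Nonempty (Homotopy (C.homMap f) (C.homMap g)) := by
  obtain ⟨s, hs⟩ := Cochain.equivHomotopy f g h
  refine ⟨(Cochain.equivHomotopy _ _).symm ⟨Cochain.mk fun p q hpq => ModuleCat.ofHom
    { toFun := fun z : Cochain M' C.toComplex p =>
        (p.negOnePow • s.comp z (by omega) : Cochain M C.toComplex q)
      map_add' := fun z z' => ?_
      map_smul' := fun b z => ?_ }, ?_⟩⟩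
  · exact (congrArg (p.negOnePow • ·) (Cochain.comp_add s z z' _)).trans (smul_add _ _ _)
  · refine Eq.trans ?_ (negOnePow_smul_comm p b (show C.HomX M q from s.comp z (by omega)))
    exact congrArg (p.negOnePow • ·) (Cochain.comp_assoc_of_third_is_zero_cochain s
      (show Cochain M' C.toComplex p from z) (Cochain.ofHom (C.smulHom b)) (by omega)).symm
  · refine Cochain.ext₀ _ _ fun p => ?_
    rw [Cochain.add_v, Cochain.ofHom_v, Cochain.ofHom_v,
      δ_v (-1) 0 (neg_add_cancel 1) _ p p (add_zero p) (p - 1) (p + 1) rfl rfl,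
      Int.negOnePow_zero, one_smul]
    ext z
    change (Cochain.ofHom f).comp (show Cochain M' C.toComplex p from z) (zero_add p) =
      δ (p - 1) p (p.negOnePow • s.comp (show Cochain M' C.toComplex p from z) (by omega)) +
      ((p + 1).negOnePow • s.comp (δ p (p + 1) (show Cochain M' C.toComplex p from z)) (by omega)) +
      (Cochain.ofHom g).comp (show Cochain M' C.toComplex p from z) (zero_add p)
    rw [hs, Cochain.add_comp]
    exact congrArg (· + _) (comp_homotopy_sign s _)

/-- The contravariant functor `Hom_A(-, C)` on homotopy categories. -/
def homotopyHom (C : BimoduleComplex A B) :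
    (HomotopyCategory (ModuleCat.{u} A) (ComplexShape.up ℤ))ᵒᵖ ⥤
      HomotopyCategory (ModuleCat.{u} B) (ComplexShape.up ℤ) :=
  Functor.leftOp (CategoryTheory.Quotient.lift _
    (C.homFunctor ⋙ (HomotopyCategory.quotient (ModuleCat.{u} B) (ComplexShape.up ℤ)).op)
    (fun _ _ _ _ ⟨h⟩ => congrArg Quiver.Hom.op
      (HomotopyCategory.eq_of_homotopy _ _ (C.homMap_homotopy h).some)))

/-- The component `M^p → C^q` of an element of `Hom_A(M, C)`. -/
def eval (C : BimoduleComplex A B) {M : CochainComplex (ModuleCat.{u} A) ℤ} {n : ℤ}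
    (z : C.HomX M n) (p q : ℤ) (h : p + n = q) : M.X p →ₗ[A] C.X q :=
  (Cochain.v (n := n) z p q h).hom

lemma eval_add (C : BimoduleComplex A B) {M : CochainComplex (ModuleCat.{u} A) ℤ} {n : ℤ}
    (z z' : C.HomX M n) (p q : ℤ) (h : p + n = q) (x : M.X p) :
    C.eval (z + z') p q h x = C.eval z p q h x + C.eval z' p q h x := rfl

lemma eval_smul (C : BimoduleComplex A B) {M : CochainComplex (ModuleCat.{u} A) ℤ} {n : ℤ}
    (b : B) (z : C.HomX M n) (p q : ℤ) (h : p + n = q) (x : M.X p) :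
    C.eval (b • z) p q h x = b • C.eval z p q h x :=
  congrArg (fun f => f.hom x)
    (Cochain.comp_zero_cochain_v (n := n) z (Cochain.ofHom (C.smulHom b)) p q h)

lemma eval_d (C : BimoduleComplex A B) {M : CochainComplex (ModuleCat.{u} A) ℤ} {n m : ℤ}
    (hnm : n + 1 = m) (z : C.HomX M n) (p q p' q' : ℤ) (h : p + m = q) (hq' : q' = q - 1)
    (hp' : p + 1 = p') (x : M.X p) :
    C.eval (((C.hom M).d n m).hom z) p q h x =
      C.d q' q (C.eval z p q' (by omega) x) +
        m.negOnePow • C.eval z p' q (by omega) ((M.d p p').hom x) :=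
  congrArg (fun f => f.hom x) (δ_v n m hnm z p q h q' p' hq' hp')

lemma HomX.ext (C : BimoduleComplex A B) {M : CochainComplex (ModuleCat.{u} A) ℤ} {n : ℤ}
    {z z' : C.HomX M n} (h : ∀ p q hpq x, C.eval z p q hpq x = C.eval z' p q hpq x) : z = z' :=
  Cochain.ext (n := n) _ _ fun p q hpq => by
    ext x
    exact h p q hpq x

/-- The element of `Hom_A(M, C)` with given components. -/
def HomX.mk (C : BimoduleComplex A B) {M : CochainComplex (ModuleCat.{u} A) ℤ} {n : ℤ}
    (f : ∀ p q : ℤ, p + n = q → (M.X p →ₗ[A] C.X q)) : C.HomX M n :=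
  Cochain.mk (G := C.toComplex) fun p q hpq => ModuleCat.ofHom (f p q hpq)

lemma eval_mk (C : BimoduleComplex A B) {M : CochainComplex (ModuleCat.{u} A) ℤ} {n : ℤ}
    (f : ∀ p q : ℤ, p + n = q → (M.X p →ₗ[A] C.X q)) (p q : ℤ) (h : p + n = q) (x : M.X p) :
    C.eval (HomX.mk C f) p q h x = f p q h x := rfl

lemma swap_sign {G H : Type*} [AddCommGroup G] [AddCommGroup H] (p q : ℤ) (d : G →+ H) (u : G)
    (w : H) :
    d ((p * q).negOnePow • u) + (p + 1).negOnePow • (p * (q + 1)).negOnePow •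
      (d u + (q + 1).negOnePow • w) = ((p + 1) * q).negOnePow • w := by
  have h : d ((p * q).negOnePow • u) = (p * q).negOnePow • d u := by
    rw [Units.smul_def, Units.smul_def, map_zsmul]
  have h1 : (p + 1).negOnePow * (p * (q + 1)).negOnePow = - (p * q).negOnePow := by
    rw [← Int.negOnePow_add, ← Int.negOnePow_succ, Int.negOnePow_eq_iff]
    exact ⟨p, by ring⟩
  have h2 : - (p * q).negOnePow * (q + 1).negOnePow = ((p + 1) * q).negOnePow := by
    rw [← Int.negOnePow_succ, ← Int.negOnePow_add, Int.negOnePow_eq_iff]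
    exact ⟨1, by ring⟩
  rw [h, smul_smul, h1, smul_add, smul_smul, h2, Units.neg_smul]
  abel

/-- The chain map `M ⟶ Hom_B(N, C)` which corresponds to a chain map `g : N ⟶ Hom_A(M, C)`; it
sends `x` in `M^p` to `(y ↦ (-1) ^ (p * q) • g y x)` for `y` in `N^q`. -/
def swap (C : BimoduleComplex A B) {M : CochainComplex (ModuleCat.{u} A) ℤ}
    {N : CochainComplex (ModuleCat.{u} B) ℤ} (g : N ⟶ C.hom M) : M ⟶ C.flip.hom N where
  f p := ModuleCat.ofHom
    { toFun := fun x => HomX.mk C.flip fun q k hqk =>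
        { toFun := fun y =>
            (p * q).negOnePow • C.eval ((g.f q).hom y) p k ((add_comm p q).trans hqk) x
          map_add' := fun y y' => by
            rw [map_add]
            exact (congrArg _ (C.eval_add _ _ _ _ _ _)).trans (smul_add _ _ _)
          map_smul' := fun b y => by
            rw [map_smul]
            exact (congrArg _ (C.eval_smul _ _ _ _ _ _)).trans (negOnePow_smul_comm _ _ _) }
      map_add' := fun x x' => HomX.ext C.flip fun q k hqk y => by
        refine Eq.trans ?_ (C.flip.eval_add _ _ _ _ _ _).symm
        rw [eval_mk, eval_mk, eval_mk]
        exact (congrArg ((p * q).negOnePow • ·)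
          (map_add (C.eval ((g.f q).hom y) p k ((add_comm p q).trans hqk)) x x')).trans
            (smul_add _ _ _)
      map_smul' := fun a x => HomX.ext C.flip fun q k hqk y => by
        refine Eq.trans ?_ (C.flip.eval_smul _ _ _ _ _ _).symm
        rw [eval_mk, eval_mk]
        exact (congrArg _ (map_smul _ _ _)).trans (negOnePow_smul_comm _ _ _) }
  comm' p p' hp := by
    obtain rfl : p + 1 = p' := hp
    ext x
    refine HomX.ext C.flip fun q k hqk y => ?_
    refine (C.flip.eval_d rfl _ q k (q + 1) (k - 1) hqk rfl rfl y).trans ?_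
    have e := congrArg (fun f => f.hom y) (g.comm q (q + 1))
    have e2 : (g.f (q + 1)).hom ((N.d q (q + 1)).hom y) =
      ((C.hom M).d q (q + 1)).hom ((g.f q).hom y) := e.symm
    have e3 := C.eval_d rfl ((g.f q).hom y) p k (p + 1) (k - 1) (by omega) rfl rfl x
    change C.d (k - 1) k ((p * q).negOnePow • C.eval ((g.f q).hom y) p (k - 1) (by omega) x) +
      (p + 1).negOnePow • (p * (q + 1)).negOnePow • C.eval ((g.f (q + 1)).hom
        ((N.d q (q + 1)).hom y)) p k (by omega) x =
      ((p + 1) * q).negOnePow • C.eval ((g.f q).hom y) (p + 1) k (by omega)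
        ((M.d p (p + 1)).hom x)
    rw [e2, e3]
    exact swap_sign p q (C.d (k - 1) k) _ _

/-- For a chain map `ψ : P ⟶ C` of complexes of `A`-modules, the chain map `B ⟶ Hom_A(P, C)` which
sends `b` to `ψ` followed by multiplication by `b`. -/
noncomputable def homothetyChainMap (C : BimoduleComplex A B) {P : CochainComplex (ModuleCat.{u} A) ℤ}
    (ψ : P ⟶ C.toComplex) :
    (HomologicalComplex.single (ModuleCat.{u} B) (ComplexShape.up ℤ) 0).obj (ModuleCat.of B B) ⟶
      C.hom P :=
  HomologicalComplex.mkHomFromSingle (ModuleCat.ofHom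
    (LinearMap.toSpanSingleton B (C.HomX P 0) (Cochain.ofHom ψ))) (fun j _ => by
    ext
    exact (congrArg (δ (F := P) (G := C.toComplex) 0 j)
      (one_smul B (show C.HomX P 0 from Cochain.ofHom ψ))).trans (δ_ofHom ψ))

lemma eval_homothetyChainMap (C : BimoduleComplex A B) {P : CochainComplex (ModuleCat.{u} A) ℤ}
    (ψ : P ⟶ C.toComplex) (b : B) (n : ℤ) (x : P.X n) :
    C.eval (LinearMap.toSpanSingleton B (C.HomX P 0) (Cochain.ofHom ψ) b) n n (add_zero n) x =
      b • (show C.X n from (ψ.f n).hom x) := by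
  refine (C.eval_smul b (Cochain.ofHom ψ) n n (add_zero n) x).trans ?_
  exact congrArg (fun f : P.X n ⟶ C.toComplex.X n => b • (show C.X n from f.hom x))
    (Cochain.ofHom_v ψ n)

/-- The complex has only finitely many nonzero cohomology groups. -/
def IsBounded (C : BimoduleComplex A B) : Prop :=
  {n : ℤ | ¬ ∀ x : C.X n, C.d n (n + 1) x = 0 → ∃ y : C.X (n - 1), C.d (n - 1) n y = x}.Finite

lemma IsBounded.flip {C : BimoduleComplex A B} (h : C.IsBounded) : C.flip.IsBounded := h

section Derived

variable [HasDerivedCategory.{w} (ModuleCat.{u} A)]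

lemma IsBounded.minus {C : BimoduleComplex A B} (h : C.IsBounded) :
    DerivedCategory.TStructure.t.minus (DerivedCategory.Q.obj C.toComplex) := by
  obtain ⟨n, hn⟩ := h.bddAbove
  refine ⟨n, ?_⟩
  refine (DerivedCategory.isLE_Q_obj_iff _ _).2 ((CochainComplex.isLE_iff _ _).2 fun i hi => ?_)
  rw [HomologicalComplex.exactAt_iff' _ (i - 1) i (i + 1) (by simp) (by simp),
    ShortComplex.moduleCat_exact_iff]
  by_contra hx
  exact absurd (hn (show i ∈ _ from hx)) (by lia)

/-- A bounded complex of bimodules, as an object of the derived category of `A`-modules. -/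
noncomputable def toMinus (C : BimoduleComplex A B) (h : C.IsBounded) :
    DerivedCategory.Minus (ModuleCat.{u} A) :=
  ⟨DerivedCategory.Q.obj C.toComplex, h.minus⟩

variable [HasDerivedCategory.{w'} (ModuleCat.{u} B)]

/-- The contravariant functor `RHom_A(-, C)`: it sends `M` to `Hom_A(P, C)`, where `P` is a
projective resolution of `M`. -/
noncomputable def rHom (C : BimoduleComplex A B) :
    (DerivedCategory.Minus (ModuleCat.{u} A))ᵒᵖ ⥤ DerivedCategory (ModuleCat.{u} B) :=
  (DerivedCategory.Minus.resFunctor (ModuleCat.{u} A)).op ⋙ C.homotopyHom ⋙ DerivedCategory.Qh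

/-- A chain map from the chosen `A`-projective resolution of `C` to `C` which represents the
isomorphism in the derived category. -/
noncomputable def resMap (C : BimoduleComplex A B) (h : C.IsBounded) :
    (C.toMinus h).res ⟶ C.toComplex :=
  (HomotopyCategory.quotient _ _).preimage
    (liftOfKProjective (C.toMinus h).res ((HomotopyCategory.quotient _ _).obj C.toComplex)
      ((C.toMinus h).resIso.hom ≫ (DerivedCategory.quotientCompQhIso _).inv.app C.toComplex))

/-- The homothety morphism `B ⟶ RHom_A(C, C)` in the derived category of `B`-modules. -/
noncomputable def homothety (C : BimoduleComplex A B) (h : C.IsBounded) :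
    (DerivedCategory.singleFunctor (ModuleCat.{u} B) 0).obj (ModuleCat.of B B) ⟶
      C.rHom.obj (Opposite.op (C.toMinus h)) :=
  DerivedCategory.Q.map (C.homothetyChainMap (C.resMap h)) ≫
    (DerivedCategory.quotientCompQhIso _).inv.app _

/-- A semi-dualizing complex of bimodules: it is bounded and both homothety morphisms are
isomorphisms in the derived categories. -/
structure IsSemidualizing (C : BimoduleComplex A B) : Prop where
  bounded : C.IsBounded
  isIso_homothety : IsIso (C.homothety bounded)
  isIso_homothety_flip : IsIso (C.flip.homothety bounded.flip)

/-- The natural morphism `M ⟶ RHom_B(RHom_A(M, C), C)`. With projective resolutions `P` of `M` and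
`P'` of `RHom_A(M, C)`, the latter given by a chain map `g : P' ⟶ Hom_A(P, C)`, it is represented by
the evaluation map `P ⟶ Hom_B(P', C)`. -/
noncomputable def biduality (C : BimoduleComplex A B) (M : DerivedCategory.Minus (ModuleCat.{u} A))
    (h : DerivedCategory.TStructure.t.minus (C.rHom.obj (Opposite.op M))) :
    M.obj ⟶ C.flip.rHom.obj (Opposite.op ⟨C.rHom.obj (Opposite.op M), h⟩) :=
  let N : DerivedCategory.Minus (ModuleCat.{u} B) := ⟨C.rHom.obj (Opposite.op M), h⟩
  let g : N.res ⟶ C.hom M.res := (HomotopyCategory.quotient _ _).preimage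
    (liftOfKProjective N.res ((HomotopyCategory.quotient _ _).obj (C.hom M.res)) N.resIso.hom)
  M.resIso.inv ≫ DerivedCategory.Qh.map ((HomotopyCategory.quotient _ _).map (C.swap g))

end Derived

end BimoduleComplex

/-- The objects of the derived category of `A`-modules with bounded cohomology, all of whose
cohomology modules are finitely generated. -/
def boundedFinite (A : Type u) [Ring A] [HasDerivedCategory.{w} (ModuleCat.{u} A)] :
    ObjectProperty (DerivedCategory (ModuleCat.{u} A)) := fun M =>
  DerivedCategory.TStructure.t.bounded M ∧
    ∀ n : ℤ, Module.Finite A ((DerivedCategory.homologyFunctor (ModuleCat.{u} A) n).obj M)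

lemma boundedFinite_le_minus (A : Type u) [Ring A] [HasDerivedCategory.{w} (ModuleCat.{u} A)] :
    boundedFinite A ≤ DerivedCategory.TStructure.t.minus :=
  fun _ h => h.1.2

namespace BimoduleComplex

variable {A B : Type u} [Ring A] [Ring B]
  [HasDerivedCategory.{w} (ModuleCat.{u} A)] [HasDerivedCategory.{w'} (ModuleCat.{u} B)]

/-- The `C`-reflexive objects `M` in the derived category of `A`-modules: `M` and `RHom_A(M, C)`
have bounded and finitely generated cohomology, and the natural morphism
`M ⟶ RHom_B(RHom_A(M, C), C)` is an isomorphism. -/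
def reflexive (C : BimoduleComplex A B) : ObjectProperty (DerivedCategory (ModuleCat.{u} A)) :=
  fun M => ∃ (hM : boundedFinite A M)
    (hN : boundedFinite B (C.rHom.obj (Opposite.op ⟨M, boundedFinite_le_minus A M hM⟩))),
    IsIso (C.biduality ⟨M, boundedFinite_le_minus A M hM⟩ (boundedFinite_le_minus B _ hN))

lemma reflexive_le_minus (C : BimoduleComplex A B) :
    C.reflexive ≤ DerivedCategory.TStructure.t.minus :=
  fun M h => boundedFinite_le_minus A M h.choose

/-- The inclusion of the full subcategory of `C`-reflexive objects. -/
noncomputable abbrev reflexiveToMinus (C : BimoduleComplex A B) :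
    C.reflexive.FullSubcategory ⥤ DerivedCategory.Minus (ModuleCat.{u} A) :=
  ObjectProperty.ιOfLE C.reflexive_le_minus

/-- The restriction of `RHom_A(-, C)` to the `C`-reflexive objects. -/
noncomputable abbrev rHomReflexive (C : BimoduleComplex A B) :
    C.reflexive.FullSubcategoryᵒᵖ ⥤ DerivedCategory (ModuleCat.{u} B) :=
  C.reflexiveToMinus.op ⋙ C.rHom

lemma minus_rHomReflexive (C : BimoduleComplex A B) (M : C.reflexive.FullSubcategory) :
    DerivedCategory.TStructure.t.minus (C.rHom.obj (Opposite.op (C.reflexiveToMinus.obj M))) :=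
  boundedFinite_le_minus B _ M.property.choose_spec.choose

end BimoduleComplex

/-! The functors `RHom_A(-, C)` and `RHom_B(-, C)` are adjoint on the right: morphisms `N ⟶
RHom_A(M, C)` correspond to morphisms `M ⟶ RHom_B(N, C)`, both being pairings of `M` and `N` with
values in `C`. On complexes this is `swap`, an involution (`swap_swap`) compatible with homotopies
(`quotient_map_swap_congr`). Since the resolutions are K-projective, it passes to the derived
category as `transpose`, which is again an involution and natural in both variables.

The biduality morphism is the transpose of an identity (`biduality_eq_transpose`). Its naturality
and the triangle identity `biduality_comp_rHom_map_biduality` therefore follow formally. If `M` is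
reflexive, its biduality morphism is invertible, hence so is the image of that morphism under
`RHom_A(-, C)`; the triangle identity then makes the biduality morphism of `RHom_A(M, C)` its
inverse. So duals of reflexive objects are reflexive, and the two biduality isomorphisms are the
unit and counit of the duality. -/

namespace BimoduleComplex

variable {A B : Type u} [Ring A] [Ring B]

/-! ### Exchanging the two variables on the level of complexes -/

section Swap

variable (C : BimoduleComplex A B) {M M' : CochainComplex (ModuleCat.{u} A) ℤ}
  {N N' : CochainComplex (ModuleCat.{u} B) ℤ}

lemma eval_homMap (f : M ⟶ M') {n : ℤ} (z : C.HomX M' n) (p q : ℤ) (h : p + n = q) (x : M.X p) :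
    C.eval (((C.homMap f).f n).hom z) p q h x = C.eval z p q h ((f.f p).hom x) :=
  congrArg (fun t => t.hom x)
    ((Cochain.zero_cochain_comp_v (n := n) (Cochain.ofHom f) z p q h).trans
      (congrArg (· ≫ Cochain.v (n := n) z p q h) (Cochain.ofHom_v f p)))

lemma swap_comp (h : N' ⟶ N) (g : N ⟶ C.hom M) :
    C.swap (h ≫ g) = C.swap g ≫ C.flip.homMap h := by
  ext p x
  refine HomX.ext C.flip fun q k hqk y => ?_
  exact (C.flip.eval_homMap h (((C.swap g).f p).hom x) q k hqk y).symm

lemma swap_comp_homMap (g : N ⟶ C.hom M') (f : M ⟶ M') :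
    C.swap (g ≫ C.homMap f) = f ≫ C.swap g := by
  ext p x
  refine HomX.ext C.flip fun q k hqk y => ?_
  exact congrArg ((p * q).negOnePow • ·) (C.eval_homMap f _ p k _ x)

/-- The sign `(-1) ^ (p * q)` is symmetric in `p` and `q` and squares to one. -/
lemma swap_swap (g : N ⟶ C.hom M) : C.flip.swap (C.swap g) = g := by
  ext q y
  refine HomX.ext C fun p k hpk x => ?_
  change (q * p).negOnePow • (p * q).negOnePow • C.eval ((g.f q).hom y) p k _ x = _
  rw [smul_smul, mul_comm q p, ← Int.negOnePow_add, Int.negOnePow_even _ ⟨p * q, rfl⟩, one_smul]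
  rfl

lemma quotient_map_swap_congr {g g' : N ⟶ C.hom M}
    (h : (HomotopyCategory.quotient _ (.up ℤ)).map g =
      (HomotopyCategory.quotient _ (.up ℤ)).map g') :
    (HomotopyCategory.quotient _ (.up ℤ)).map (C.swap g) =
      (HomotopyCategory.quotient _ (.up ℤ)).map (C.swap g') := by
  -- Every swap factors through the universal evaluation map `C.swap (𝟙 _)`, so it suffices that
  -- `homMap` respects homotopies.
  have key (t : N ⟶ C.hom M) : C.swap t = C.swap (𝟙 _) ≫ C.flip.homMap t := by
    rw [← swap_comp, Category.comp_id]
  rw [key g, key g', Functor.map_comp, Functor.map_comp]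
  congr 1
  exact HomotopyCategory.eq_of_homotopy _ _
    (C.flip.homMap_homotopy (HomotopyCategory.homotopyOfEq _ _ h)).some

end Swap

/-! ### The adjunction in the derived category -/

section Transpose

variable [HasDerivedCategory.{w} (ModuleCat.{u} A)]

/-- A chain map between resolutions which represents a morphism. -/
noncomputable def resLift {M M' : DerivedCategory.Minus (ModuleCat.{u} A)} (f : M ⟶ M') :
    M.res ⟶ M'.res :=
  (HomotopyCategory.quotient _ _).preimage
    ((DerivedCategory.Minus.resFunctor (ModuleCat.{u} A)).map f)

lemma quotient_map_resLift {M M' : DerivedCategory.Minus (ModuleCat.{u} A)} (f : M ⟶ M') :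
    (HomotopyCategory.quotient _ _).map (resLift f) =
      (DerivedCategory.Minus.resFunctor (ModuleCat.{u} A)).map f :=
  Functor.map_preimage _ _

lemma Qh_map_resLift {M M' : DerivedCategory.Minus (ModuleCat.{u} A)} (f : M ⟶ M') :
    DerivedCategory.Qh.map ((HomotopyCategory.quotient _ _).map (resLift f)) =
      M.resIso.hom ≫ f.hom ≫ M'.resIso.inv := by
  rw [quotient_map_resLift]
  exact map_liftOfKProjective _ _ _

variable [HasDerivedCategory.{w'} (ModuleCat.{u} B)]
  (C : BimoduleComplex A B) {M M' : DerivedCategory.Minus (ModuleCat.{u} A)}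
  {N N' : DerivedCategory.Minus (ModuleCat.{u} B)}
  {K K' : CochainComplex (ModuleCat.{u} B) ℤ}

/-- The morphism to `RHom_A(M, C)` in the derived category which is represented by a chain map to
`Hom_A(P, C)`, for `P` the chosen resolution of `M`. -/
noncomputable def toRHom (g : K ⟶ C.hom M.res) :
    DerivedCategory.Qh.obj ((HomotopyCategory.quotient _ _).obj K) ⟶
      C.rHom.obj (Opposite.op M) :=
  DerivedCategory.Qh.map ((HomotopyCategory.quotient _ _).map g)

lemma toRHom_comp (h : K' ⟶ K) (g : K ⟶ C.hom M.res) :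
    C.toRHom (h ≫ g) =
      DerivedCategory.Qh.map ((HomotopyCategory.quotient _ _).map h) ≫ C.toRHom g :=
  (congrArg DerivedCategory.Qh.map (Functor.map_comp _ _ _)).trans (Functor.map_comp _ _ _)

lemma toRHom_comp_homMap (g : K ⟶ C.hom M'.res) (f : M ⟶ M') :
    C.toRHom (g ≫ C.homMap (resLift f)) = C.toRHom g ≫ C.rHom.map f.op := by
  have h : C.rHom.map f.op =
      DerivedCategory.Qh.map ((HomotopyCategory.quotient _ _).map (C.homMap (resLift f))) := by
    -- Once the map of resolutions is the class of a chain map, `homotopyHom` computes on that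
    -- representative by definition.
    change DerivedCategory.Qh.map (C.homotopyHom.map
      ((DerivedCategory.Minus.resFunctor (ModuleCat.{u} A)).map f).op) = _
    rw [← quotient_map_resLift]
    rfl
  rw [h]
  exact (congrArg DerivedCategory.Qh.map (Functor.map_comp _ _ _)).trans (Functor.map_comp _ _ _)

/-- Out of a K-projective complex, morphisms in the derived category are homotopy classes, and each
class contains a chain map. -/
lemma exists_toRHom_eq [K.IsKProjective]
    (φ : DerivedCategory.Qh.obj ((HomotopyCategory.quotient _ _).obj K) ⟶
      C.rHom.obj (Opposite.op M)) : ∃ g, C.toRHom g = φ := by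
  obtain ⟨t, ht⟩ := (CochainComplex.IsKProjective.Qh_map_bijective K
    ((HomotopyCategory.quotient _ _).obj (C.hom M.res))).surjective φ
  obtain ⟨g, rfl⟩ := (HomotopyCategory.quotient _ _).map_surjective t
  exact ⟨g, ht⟩

lemma toRHom_swap_congr {P : CochainComplex (ModuleCat.{u} A) ℤ}
    {g g' : N.res ⟶ C.hom P}
    (h : DerivedCategory.Qh.map ((HomotopyCategory.quotient _ (.up ℤ)).map g) =
      DerivedCategory.Qh.map ((HomotopyCategory.quotient _ (.up ℤ)).map g')) :
    C.flip.toRHom (M := N) (C.swap g) = C.flip.toRHom (M := N) (C.swap g') :=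
  congrArg DerivedCategory.Qh.map (C.quotient_map_swap_congr
    ((CochainComplex.IsKProjective.Qh_map_bijective _ _).injective h))

/-- The morphism `M ⟶ RHom_B(N, C)` which corresponds to a morphism `N ⟶ RHom_A(M, C)`. -/
noncomputable def transpose (φ : N.obj ⟶ C.rHom.obj (Opposite.op M)) :
    M.obj ⟶ C.flip.rHom.obj (Opposite.op N) :=
  M.resIso.inv ≫ C.flip.toRHom (C.swap (C.exists_toRHom_eq (N.resIso.hom ≫ φ)).choose)

/-- Independence of the chosen representative: two chain maps out of the K-projective `N.res` that
agree in the derived category are homotopic, and so are their swaps. Later proofs can thus pick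
convenient representatives. -/
lemma transpose_eq (φ : N.obj ⟶ C.rHom.obj (Opposite.op M)) (g : N.res ⟶ C.hom M.res)
    (hg : C.toRHom g = N.resIso.hom ≫ φ) :
    C.transpose φ = M.resIso.inv ≫ C.flip.toRHom (C.swap g) :=
  congrArg (M.resIso.inv ≫ ·) (C.toRHom_swap_congr
    ((C.exists_toRHom_eq (N.resIso.hom ≫ φ)).choose_spec.trans hg.symm))

lemma transpose_transpose (φ : N.obj ⟶ C.rHom.obj (Opposite.op M)) :
    C.flip.transpose (C.transpose φ) = φ := by
  obtain ⟨g, hg⟩ := C.exists_toRHom_eq (N.resIso.hom ≫ φ)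
  rw [C.flip.transpose_eq (C.transpose φ) (C.swap g)
    (by rw [C.transpose_eq φ g hg, Iso.hom_inv_id_assoc]), swap_swap]
  exact (Iso.inv_comp_eq _).2 hg

lemma transpose_comp (h : N' ⟶ N) (φ : N.obj ⟶ C.rHom.obj (Opposite.op M)) :
    C.transpose (h.hom ≫ φ) = C.transpose φ ≫ C.flip.rHom.map h.op := by
  obtain ⟨g, hg⟩ := C.exists_toRHom_eq (N.resIso.hom ≫ φ)
  rw [C.transpose_eq _ (resLift h ≫ g), swap_comp, C.transpose_eq φ g hg, toRHom_comp_homMap,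
    Category.assoc]
  rw [toRHom_comp, hg, Qh_map_resLift]
  simp

lemma transpose_comp_rHom_map (φ : N.obj ⟶ C.rHom.obj (Opposite.op M')) (f : M ⟶ M') :
    C.transpose (φ ≫ C.rHom.map f.op) = f.hom ≫ C.transpose φ := by
  obtain ⟨g, hg⟩ := C.exists_toRHom_eq (N.resIso.hom ≫ φ)
  rw [C.transpose_eq _ (g ≫ C.homMap (resLift f)), swap_comp_homMap, C.transpose_eq φ g hg,
    toRHom_comp, Qh_map_resLift]
  · simp
  · rw [toRHom_comp_homMap, hg, Category.assoc]

/-- The chain map used to define `biduality` lifts `N.resIso.hom`, so it represents the identity of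
`RHom_A(M, C)`. -/
lemma biduality_eq_transpose (M : DerivedCategory.Minus (ModuleCat.{u} A))
    (h : DerivedCategory.TStructure.t.minus (C.rHom.obj (Opposite.op M))) :
    C.biduality M h =
      C.transpose (N := ⟨C.rHom.obj (Opposite.op M), h⟩) (𝟙 (C.rHom.obj (Opposite.op M))) := by
  refine (C.transpose_eq (N := ⟨C.rHom.obj (Opposite.op M), h⟩) _ _ ?_).symm
  refine Eq.trans ?_ (Category.comp_id _).symm
  refine (congrArg DerivedCategory.Qh.map (Functor.map_preimage _ _)).trans ?_
  exact map_liftOfKProjective _ _ _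

lemma biduality_naturality (f : M ⟶ M')
    (h : DerivedCategory.TStructure.t.minus (C.rHom.obj (Opposite.op M)))
    (h' : DerivedCategory.TStructure.t.minus (C.rHom.obj (Opposite.op M'))) :
    f.hom ≫ C.biduality M' h' = C.biduality M h ≫ C.flip.rHom.map
      (ObjectProperty.homMk (C.rHom.map f.op) :
        (⟨_, h'⟩ : DerivedCategory.Minus (ModuleCat.{u} B)) ⟶ ⟨_, h⟩).op := by
  -- Naturality in each variable turns both sides into the transpose of `C.rHom.map f.op`, composed
  -- with an identity on one side or the other.
  rw [biduality_eq_transpose, biduality_eq_transpose, ← transpose_comp_rHom_map, ← transpose_comp]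
  congr 1
  exact (Category.id_comp _).trans (Category.comp_id _).symm

/-- The triangle identity for the biduality morphisms. -/
lemma biduality_comp_rHom_map_biduality (M : DerivedCategory.Minus (ModuleCat.{u} A))
    (h : DerivedCategory.TStructure.t.minus (C.rHom.obj (Opposite.op M)))
    (h' : DerivedCategory.TStructure.t.minus (C.flip.rHom.obj (Opposite.op
      (⟨C.rHom.obj (Opposite.op M), h⟩ : DerivedCategory.Minus (ModuleCat.{u} B))))) :
    C.flip.biduality ⟨C.rHom.obj (Opposite.op M), h⟩ h' ≫ C.rHom.map
      (ObjectProperty.homMk (C.biduality M h) :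
        M ⟶ (⟨_, h'⟩ : DerivedCategory.Minus (ModuleCat.{u} A))).op = 𝟙 _ := by
  rw [biduality_eq_transpose]
  -- By naturality the composite is the transpose of `C.biduality M h`, hence the double transpose
  -- of an identity.
  refine (C.flip.transpose_comp (N := ⟨_, h'⟩) (M := ⟨C.rHom.obj (Opposite.op M), h⟩)
    (ObjectProperty.homMk (C.biduality M h)) (𝟙 _)).symm.trans ?_
  refine (congrArg C.flip.transpose (Category.comp_id _)).trans ?_
  change C.flip.transpose (N := M) (M := ⟨C.rHom.obj (Opposite.op M), h⟩) (C.biduality M h) = _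
  rw [biduality_eq_transpose, transpose_transpose]

end Transpose

end BimoduleComplex

/-! ### Reflexive objects and the duality -/

instance (A : Type u) [Ring A] [HasDerivedCategory.{w} (ModuleCat.{u} A)] :
    (boundedFinite A).IsClosedUnderIsomorphisms where
  of_iso e h := ⟨ObjectProperty.prop_of_iso _ e h.1, fun n =>
    have := h.2 n
    Module.Finite.equiv ((DerivedCategory.homologyFunctor _ n).mapIso e).toLinearEquiv⟩

namespace BimoduleComplex

variable {A B : Type u} [Ring A] [Ring B]
  [HasDerivedCategory.{w} (ModuleCat.{u} A)] [HasDerivedCategory.{w'} (ModuleCat.{u} B)]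
  (C : BimoduleComplex A B)

/-- `RHom_A(-, C)` sends `C`-reflexive objects to `C`-reflexive objects. -/
lemma reflexive_rHomReflexive (M : C.reflexive.FullSubcategoryᵒᵖ) :
    C.flip.reflexive (C.rHomReflexive.obj M) := by
  obtain ⟨M, hM, hN, h⟩ := M
  -- The finiteness condition on the dual of `RHom_A(M, C)` concerns the double dual of `M`, which
  -- is isomorphic to `M`.
  have hM' := ObjectProperty.prop_of_iso _ (@asIso _ _ _ _ _ h) hM
  refine ⟨hN, hM', ?_⟩
  let e : (⟨M, boundedFinite_le_minus A M hM⟩ : DerivedCategory.Minus (ModuleCat.{u} A)) ≅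
      ⟨_, boundedFinite_le_minus A _ hM'⟩ :=
    ObjectProperty.isoMk _ (@asIso _ _ _ _ _ h)
  -- In the triangle identity the second factor is invertible, being the image of the isomorphism
  -- `e`; hence so is the first.
  exact @isIso_of_comp_hom_eq_id _ _ _ _ _ (C.rHom.mapIso e.op).isIso_hom _
    (C.biduality_comp_rHom_map_biduality ⟨M, boundedFinite_le_minus A M hM⟩
      (boundedFinite_le_minus B _ hN) (boundedFinite_le_minus A _ hM'))

/-- The duality functor on `C`-reflexive objects. -/
noncomputable abbrev duality :
    C.reflexive.FullSubcategoryᵒᵖ ⥤ C.flip.reflexive.FullSubcategory :=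
  C.flip.reflexive.lift C.rHomReflexive C.reflexive_rHomReflexive

lemma isIso_biduality (M : C.reflexive.FullSubcategory) :
    IsIso (C.biduality (C.reflexiveToMinus.obj M) (C.minus_rHomReflexive M)) :=
  M.property.choose_spec.choose_spec

/-- The biduality morphisms, as a natural isomorphism. -/
noncomputable def bidualityIso :
    𝟭 C.reflexive.FullSubcategory ≅ C.duality.rightOp ⋙ C.flip.duality :=
  NatIso.ofComponents
    (fun M => ObjectProperty.isoMk _ (@asIso _ _ _ _ _ (C.isIso_biduality M)))
    (fun {M M'} f => by
      ext
      exact C.biduality_naturality (C.reflexiveToMinus.map f) (C.minus_rHomReflexive M)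
        (C.minus_rHomReflexive M'))

instance : C.duality.IsEquivalence := by
  let e : C.reflexive.FullSubcategory ≌ C.flip.reflexive.FullSubcategoryᵒᵖ :=
    -- The counit is the biduality of the other side: passing to opposite categories reverses its
    -- direction. Here `C.flip.flip` is `C` by definition.
    CategoryTheory.Equivalence.mk C.duality.rightOp C.flip.duality C.bidualityIso
      (NatIso.op C.flip.bidualityIso)
  have : C.duality.rightOp.IsEquivalence := e.isEquivalence_functor
  exact inferInstanceAs (C.duality.rightOp.leftOp.IsEquivalence)

end BimoduleComplex

theorem theorem3p12 {R S : Type u} [Ring R] [Ring S] [IsNoetherianRing R] [IsNoetherianRing Sᵐᵒᵖ]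
    [HasDerivedCategory.{w} (ModuleCat.{u} R)] [HasDerivedCategory.{w'} (ModuleCat.{u} Sᵐᵒᵖ)]
    (C : BimoduleComplex R Sᵐᵒᵖ) (hC : C.IsSemidualizing) :
    ∃ (hR : ∀ M, C.flip.reflexive (C.rHomReflexive.obj M))
      (hS : ∀ N, C.reflexive (C.flip.rHomReflexive.obj N)),
      let F : C.reflexive.FullSubcategoryᵒᵖ ⥤ C.flip.reflexive.FullSubcategory :=
        C.flip.reflexive.lift C.rHomReflexive hR
      let G : C.flip.reflexive.FullSubcategoryᵒᵖ ⥤ C.reflexive.FullSubcategory :=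
        C.reflexive.lift C.flip.rHomReflexive hS
      F.IsEquivalence ∧ G.IsEquivalence ∧
      (∃ η : 𝟭 C.reflexive.FullSubcategory ≅ F.rightOp ⋙ G,
        ∀ M, (η.hom.app M).hom =
          C.biduality (C.reflexiveToMinus.obj M) (C.minus_rHomReflexive M)) ∧
      (∃ ε : 𝟭 C.flip.reflexive.FullSubcategory ≅ G.rightOp ⋙ F,
        ∀ N, (ε.hom.app N).hom =
          C.flip.biduality (C.flip.reflexiveToMinus.obj N) (C.flip.minus_rHomReflexive N)) :=
  ⟨C.reflexive_rHomReflexive, C.flip.reflexive_rHomReflexive,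
    inferInstanceAs C.duality.IsEquivalence, inferInstanceAs C.flip.duality.IsEquivalence,
    ⟨C.bidualityIso, fun _ => rfl⟩, ⟨C.flip.bidualityIso, fun _ => rfl⟩⟩
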